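/- Let $\mathcal H=\mathbb C^{n_1}\otimes\cdots\otimes\mathbb C^{n_s}$ and $n=n_1\cdots n_s$. A state is a positive semidefinite $n\times n$ matrix of trace one, acting on $\mathcal H$. Let $\mathcal D$ be either the set of separable states (convex combinations of tensor products of states of the $s$ parties) or the set of PPT states (states whose partial transpose is positive semidefinite for each group of parties in a fixed family, e.g. for one bipartition or for all of them). For states $\rho,\sigma$ let $S(\rho\|\sigma)=\operatorname{Tr}(\rho\log\rho-\rho\log\sigma)$, which is $+\infty$ if $\ker\sigma\not\subseteq\ker\rho$. A state $\sigma\in\mathcal D$ is called a closest separable state (CSS; closest PPT state in the PPT case) of $\rho$ if $S(\rho\|\sigma)=\min_{\sigma'\in\mathcal D}S(\rho\|\sigma')$. Let $\rho>0$ be a full-rank state that is entangled, i.e. $\rho\notin\mathcal D$, let $\sigma$ be a CSS of $\rho$, and put $\rho(t)=t\rho+(1-t)\sigma$ for $t\in\mathbb R$. Then there is a largest real number $t_{\max}$ with $\rho(t_{\max})\ge 0$, it satisfies $t_{\max}>1$, and for every $t\in[0,t_{\max}]$ the matrix $\rho(t)$ is a state and $\sigma$ is a CSS of $\rho(t)$.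 -/

import Mathlib

open scoped Matrix ComplexOrder

namespace QState

/-- A density matrix (state): positive semidefinite of trace one. -/
def IsState {d : Type*} [Fintype d] (ρ : Matrix d d ℂ) : Prop :=
  ρ.PosSemidef ∧ ρ.trace = 1

open Classical in
/-- The quantum relative entropy `S(ρ‖σ) = Tr (ρ log ρ - ρ log σ)` of states, with the value `+∞`
when the kernel of `σ` is not contained in the kernel of `ρ`. The logarithm is taken through the
functional calculus of Hermitian matrices with `Real.log 0 = 0`, so that `0 log 0 = 0`; when the
kernel of `σ` lies in the kernel of `ρ`, the value of `log σ` on that kernel is irrelevant. -/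
noncomputable def relEntropy {d : Type*} [Fintype d] [DecidableEq d] (ρ σ : Matrix d d ℂ) :
    EReal :=
  if ∀ x : d → ℂ, σ *ᵥ x = 0 → ρ *ᵥ x = 0 then
    (((ρ * cfc Real.log ρ - ρ * cfc Real.log σ).trace.re : ℝ) : EReal)
  else ⊤

/-- `σ` attains the minimum of the relative entropy `S(ρ‖·)` over the set `D`
(for `D` the separable or the PPT states: `σ` is a closest separable, or PPT, state of `ρ`). -/
def IsClosestState {d : Type*} [Fintype d] [DecidableEq d] (D : Set (Matrix d d ℂ))
    (ρ σ : Matrix d d ℂ) : Prop :=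
  σ ∈ D ∧ ∀ σ' ∈ D, relEntropy ρ σ ≤ relEntropy ρ σ'

/-- The standard basis labels of `ℂ^(n 0) ⊗ ⋯ ⊗ ℂ^(n (s-1))`. -/
abbrev Idx {s : ℕ} (n : Fin s → ℕ) : Type := ∀ i : Fin s, Fin (n i)

/-- The tensor (Kronecker) product of one matrix for each party. -/
def tensor {s : ℕ} {n : Fin s → ℕ} (τ : ∀ i : Fin s, Matrix (Fin (n i)) (Fin (n i)) ℂ) :
    Matrix (Idx n) (Idx n) ℂ :=
  Matrix.of fun x y => ∏ i, τ i (x i) (y i)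

/-- The separable states: the convex combinations of product states. -/
def separableStates {s : ℕ} (n : Fin s → ℕ) : Set (Matrix (Idx n) (Idx n) ℂ) :=
  convexHull ℝ {M | ∃ τ : ∀ i : Fin s, Matrix (Fin (n i)) (Fin (n i)) ℂ,
    (∀ i, IsState (τ i)) ∧ M = tensor τ}

/-- The partial transpose with respect to the parties in `S`. -/
def partialTranspose {s : ℕ} {n : Fin s → ℕ} (S : Finset (Fin s))
    (M : Matrix (Idx n) (Idx n) ℂ) : Matrix (Idx n) (Idx n) ℂ :=
  Matrix.of fun x y =>
    M (fun i => if i ∈ S then y i else x i) (fun i => if i ∈ S then x i else y i)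

/-- The states whose partial transpose with respect to each of the groups of parties in the family
`F` is positive semidefinite. For two parties take `F = {{0}}` (the usual PPT states); for several
parties, `F = Set.univ` asks for PPT across every bipartition. -/
def pptStates {s : ℕ} (n : Fin s → ℕ) (F : Set (Finset (Fin s))) :
    Set (Matrix (Idx n) (Idx n) ℂ) :=
  {M | IsState M ∧ ∀ S ∈ F, (partialTranspose S M).PosSemidef}

end QState

/-! Write L(A, B) = Re Tr(A log B); a closest state maximises L(ρ, ·) on D. Since D contains a
multiple of 1, the minimum is finite, which forces σ to be full rank. Let R = ρ(t) ≥ 0 with t ≥ 0,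
let τ ∈ D be full rank and put F = (1-ε)σ + ετ. Operator concavity of log gives ε(L(R,τ) - L(R,σ)) ≤
L(R,F) - L(R,σ). By linearity in R and optimality of σ for ρ, the right side is at most (t-1)
S(σ‖F), and by Klein's inequality 0 ≤ S(σ‖F) ≤ S(σ‖F) + S(F‖σ) = ε Re Tr((σ-τ)(log σ - log F)) =
o(ε). Dividing by ε and letting ε → 0 shows that σ beats τ, without differentiating log. Singular τ
follow by mixing with the multiple of 1. -/

open Filter Topology

namespace QState

/-! ### Klein's inequality -/

section LogTrace

variable {d : Type*} [Fintype d] [DecidableEq d]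

/-- The real part of `Tr (A log B)`. -/
noncomputable def logTrace (A B : Matrix d d ℂ) : ℝ :=
  (A * cfc Real.log B).trace.re

theorem logTrace_add_left (A A' B : Matrix d d ℂ) :
    logTrace (A + A') B = logTrace A B + logTrace A' B := by
  simp [logTrace, add_mul]

theorem logTrace_sub_left (A A' B : Matrix d d ℂ) :
    logTrace (A - A') B = logTrace A B - logTrace A' B := by
  simp [logTrace, sub_mul]

theorem logTrace_smul_left (c : ℝ) (A B : Matrix d d ℂ) :
    logTrace (c • A) B = c * logTrace A B := by
  simp [logTrace]

open scoped MatrixOrder Matrix.Norms.L2Operator in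
theorem exists_eq_conjTranspose_mul_self {A : Matrix d d ℂ} (hA : A.PosSemidef) :
    ∃ C : Matrix d d ℂ, A = Cᴴ * C :=
  CStarAlgebra.nonneg_iff_eq_star_mul_self.mp (Matrix.nonneg_iff_posSemidef.mpr hA)

theorem trace_mul_nonneg {A B : Matrix d d ℂ} (hA : A.PosSemidef) (hB : B.PosSemidef) :
    0 ≤ (A * B).trace.re := by
  obtain ⟨C, rfl⟩ := exists_eq_conjTranspose_mul_self hB
  have h := (hA.mul_mul_conjTranspose_same C).trace_nonneg
  rw [← Matrix.mul_assoc, Matrix.trace_mul_comm, ← Matrix.mul_assoc]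
  exact (Complex.le_def.mp h).1

theorem trace_mul_cfc (A : Matrix d d ℂ) {B : Matrix d d ℂ} (hB : B.IsHermitian) (f : ℝ → ℝ) :
    (A * cfc f B).trace.re = ∑ j, f (hB.eigenvalues j) *
      ((star (hB.eigenvectorUnitary : Matrix d d ℂ) * A *
        (hB.eigenvectorUnitary : Matrix d d ℂ)) j j).re := by
  rw [hB.cfc_eq, Matrix.IsHermitian.cfc, Unitary.conjStarAlgAut_apply, ← Matrix.mul_assoc,
    Matrix.trace_mul_comm, ← Matrix.mul_assoc, ← Matrix.mul_assoc, Matrix.trace, Complex.re_sum]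
  refine Finset.sum_congr rfl fun j _ => ?_
  simp [Matrix.mul_diagonal, mul_comm]

theorem klein_inequality {A B : Matrix d d ℂ} (hA : A.PosDef) (hB : B.PosDef) :
    A.trace.re - B.trace.re ≤ logTrace A A - logTrace A B := by
  set U : Matrix d d ℂ := (hB.isHermitian.eigenvectorUnitary : Matrix d d ℂ) with hU
  have hUU : U * star U = 1 := Unitary.coe_mul_star_self _
  have htr : ∀ M : Matrix d d ℂ, (∑ j, (star U * M * U) j j).re = M.trace.re := fun M => by
    change (star U * M * U).trace.re = _
    rw [Matrix.trace_mul_comm, ← Matrix.mul_assoc, hUU, one_mul]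
  have hAsa : IsSelfAdjoint A := hA.isHermitian
  have hBtr : B.trace.re = ∑ j, hB.isHermitian.eigenvalues j := by
    rw [hB.isHermitian.trace_eq_sum_eigenvalues]; simp
  have hspec : ∀ x ∈ spectrum ℝ A, 0 < x := by
    intro x hx
    rw [hA.isHermitian.spectrum_real_eq_range_eigenvalues] at hx
    obtain ⟨i, rfl⟩ := hx
    exact hA.eigenvalues_pos i
  have hcont : ∀ f : ℝ → ℝ, ContinuousOn f (spectrum ℝ A) := fun f =>
    (Matrix.finite_real_spectrum (A := A)).continuousOn f
  -- The scalar inequality x log x - (log b + 1) x + b ≥ 0, applied to A; below, b runs over the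
  -- eigenvalues of B and the diagonal entries in the eigenbasis of B are summed.
  have key : ∀ b : ℝ, 0 < b →
      (A * cfc Real.log A - (Real.log b + 1) • A + b • (1 : Matrix d d ℂ)).PosSemidef := by
    intro b hb
    have e : A * cfc Real.log A - (Real.log b + 1) • A + b • (1 : Matrix d d ℂ)
        = cfc (fun x : ℝ => x * Real.log x - (Real.log b + 1) * x + b) A := by
      rw [cfc_add (hf := hcont _) (hg := hcont _), cfc_sub (hf := hcont _) (hg := hcont _),
        cfc_mul (hf := hcont _) (hg := hcont _), cfc_const_mul _ (fun x : ℝ => x) A (hf := hcont _), cfc_id' ℝ A, cfc_const b A,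
        Algebra.algebraMap_eq_smul_one]
    rw [e]
    open scoped MatrixOrder in
    refine Matrix.nonneg_iff_posSemidef.mp (cfc_nonneg fun x hx => ?_)
    have hx := hspec x hx
    have h := Real.log_le_sub_one_of_pos (div_pos hb hx)
    rw [Real.log_div hb.ne' hx.ne'] at h
    have h2 := mul_le_mul_of_nonneg_left h hx.le
    have h3 : x * (b / x - 1) = b - x := by field_simp
    nlinarith
  have hj : ∀ j, 0 ≤ ((star U * (A * cfc Real.log A) * U) j j).re -
      (Real.log (hB.isHermitian.eigenvalues j) + 1) * ((star U * A * U) j j).re +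
      hB.isHermitian.eigenvalues j := by
    intro j
    have h := ((key _ (hB.eigenvalues_pos j)).conjTranspose_mul_mul_same U).diag_nonneg (i := j)
    have h1 : star U * U = 1 := Unitary.coe_star_mul_self _
    rw [← Matrix.star_eq_conjTranspose, mul_add, mul_sub, add_mul, sub_mul, mul_smul_comm,
      mul_smul_comm, smul_mul_assoc, smul_mul_assoc, mul_one, h1] at h
    have := (Complex.le_def.mp h).1
    simpa using this
  have hs := Finset.sum_nonneg fun j (_ : j ∈ Finset.univ) => hj j
  rw [Finset.sum_add_distrib, Finset.sum_sub_distrib, ← Complex.re_sum, htr, ← hBtr] at hs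
  simp only [add_mul, one_mul, Finset.sum_add_distrib] at hs
  rw [← Complex.re_sum (f := fun j => (star U * A * U) j j), htr, ← trace_mul_cfc A hB.isHermitian] at hs
  simp only [logTrace]
  linarith

end LogTrace

/-! ### Concavity and continuity of the logarithm; operator bounds -/

section OperatorNorm

open scoped MatrixOrder Matrix.Norms.L2Operator

variable {d : Type*} [Fintype d] [DecidableEq d]

theorem logTrace_concave {A B C : Matrix d d ℂ} (hA : A.PosSemidef) (hB : B.PosDef)
    (hC : C.PosDef) {a b : ℝ} (ha : 0 ≤ a) (hb : 0 ≤ b) (hab : a + b = 1) :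
    a * logTrace A B + b * logTrace A C ≤ logTrace A (a • B + b • C) := by
  have h := (CFC.concaveOn_log (A := Matrix d d ℂ)).2
    (Matrix.isStrictlyPositive_iff_posDef.mpr hB) (Matrix.isStrictlyPositive_iff_posDef.mpr hC)
    ha hb hab
  have := trace_mul_nonneg hA (Matrix.le_iff.mp h)
  simp only [CFC.log, mul_sub, mul_add, mul_smul_comm, Matrix.trace_sub, Matrix.trace_add,
    Matrix.trace_smul, Complex.sub_re, Complex.add_re, Complex.real_smul, Complex.re_ofReal_mul] at this
  simp only [logTrace]
  linarith

theorem tendsto_logTrace_right (A : Matrix d d ℂ) {B : Matrix d d ℂ} (hB : B.PosDef)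
    {ι : Type*} {l : Filter ι} {F : ι → Matrix d d ℂ} (hF : Tendsto F l (𝓝 B))
    (hpos : ∀ᶠ i in l, (F i).PosDef) :
    Tendsto (fun i => logTrace A (F i)) l (𝓝 (logTrace A B)) := by
  have hlog := (CFC.continuousOn_log (A := Matrix d d ℂ)).continuousWithinAt
    (x := B) ⟨hB.isHermitian, hB.isUnit⟩
  have h : Tendsto (fun i => CFC.log (F i)) l (𝓝 (CFC.log B)) :=
    hlog.tendsto.comp (tendsto_nhdsWithin_iff.mpr
      ⟨hF, hpos.mono fun i hi => ⟨hi.isHermitian, hi.isUnit⟩⟩)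
  have hc : Continuous fun M : Matrix d d ℂ => (A * M).trace.re := by fun_prop
  exact (hc.tendsto _).comp h

theorem isClosed_setOf_posSemidef {F : ℝ → Matrix d d ℂ} (hF : Continuous F) :
    IsClosed {t | (F t).PosSemidef} := by
  simp only [← Matrix.nonneg_iff_posSemidef]
  exact isClosed_le continuous_const hF

theorem exists_pos_smul_one_le {A : Matrix d d ℂ} (hA : A.PosDef) :
    ∃ c : ℝ, 0 < c ∧ (A - c • 1).PosSemidef := by
  cases isEmpty_or_nonempty d
  · exact ⟨1, one_pos, Subsingleton.elim 0 (A - _) ▸ Matrix.PosSemidef.zero⟩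
  obtain ⟨c, hc, h⟩ := (CFC.exists_pos_algebraMap_le_iff hA.isHermitian).mpr
    (fun x hx => by
      rw [hA.isHermitian.spectrum_real_eq_range_eigenvalues] at hx
      obtain ⟨i, rfl⟩ := hx
      exact hA.eigenvalues_pos i)
  rw [Algebra.algebraMap_eq_smul_one] at h
  exact ⟨c, hc, Matrix.le_iff.mp h⟩

theorem exists_pos_le_smul_one {A : Matrix d d ℂ} (hA : A.IsHermitian) :
    ∃ c : ℝ, 0 < c ∧ (c • 1 - A).PosSemidef := by
  refine ⟨‖A‖ + 1, by positivity, ?_⟩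
  have h := IsSelfAdjoint.le_algebraMap_norm_self (a := A) hA
  rw [Algebra.algebraMap_eq_smul_one] at h
  have := (Matrix.le_iff.mp h).add (Matrix.PosSemidef.one (n := d) (R := ℂ))
  rwa [add_smul, one_smul, add_sub_right_comm]

end OperatorNorm

/-! ### Optimality along the ray, and approximation of singular states -/

section Segment

variable {d : Type*} [Fintype d] [DecidableEq d]

theorem logTrace_le_of_isMinimum {D : Set (Matrix d d ℂ)} (hconv : Convex ℝ D)
    (htr : ∀ τ ∈ D, τ.trace = 1) {ρ σ τ : Matrix d d ℂ} (hσD : σ ∈ D) (hσ : σ.PosDef)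
    (hmax : ∀ τ ∈ D, τ.PosDef → logTrace ρ τ ≤ logTrace ρ σ) {t : ℝ} (ht : 0 ≤ t)
    (hR : (t • ρ + (1 - t) • σ).PosSemidef) (hτD : τ ∈ D) (hτ : τ.PosDef) :
    logTrace (t • ρ + (1 - t) • σ) τ ≤ logTrace (t • ρ + (1 - t) • σ) σ := by
  let F : ℝ → Matrix d d ℂ := fun ε => (1 - ε) • σ + ε • τ
  have hFpos : ∀ ε ∈ Set.Ioo (0 : ℝ) 1, (F ε).PosDef := fun ε hε =>
    (hσ.smul (sub_pos.mpr hε.2)).add (hτ.smul hε.1)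
  have hFD : ∀ ε ∈ Set.Ioo (0 : ℝ) 1, F ε ∈ D := fun ε hε =>
    hconv hσD hτD (sub_pos.mpr hε.2).le hε.1.le (by ring)
  have hev : ∀ᶠ ε in 𝓝[>] (0 : ℝ), ε ∈ Set.Ioo (0 : ℝ) 1 := Ioo_mem_nhdsGT one_pos
  have hF0 : Tendsto F (𝓝[>] 0) (𝓝 σ) := by
    have hc : Continuous F := by fun_prop
    simpa [F] using (hc.tendsto 0).mono_left nhdsWithin_le_nhds
  have hlim : Tendsto (fun ε => |t - 1| * (logTrace (σ - τ) σ - logTrace (σ - τ) (F ε)))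
      (𝓝[>] 0) (𝓝 0) := by
    have := tendsto_logTrace_right (σ - τ) hσ hF0 (hev.mono hFpos)
    simpa using (this.const_sub (logTrace (σ - τ) σ)).const_mul |t - 1|
  rw [← sub_nonpos]
  refine ge_of_tendsto hlim (hev.mono fun ε hε => ?_)
  have hFp := hFpos ε hε
  have hFd := hFD ε hε
  have htrF : (F ε).trace = σ.trace := by rw [htr _ hFd, htr _ hσD]
  -- `k1` allows t - 1 to be replaced by |t - 1|; `k2` bounds S(σ‖F ε) by the symmetrised entropy,
  -- which carries the factor ε.
  have k1 := klein_inequality hσ hFp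
  have k2 := klein_inequality hFp hσ
  have hconc := logTrace_concave hR hσ hτ (sub_pos.mpr hε.2).le hε.1.le (by ring)
  have hm := mul_le_mul_of_nonneg_left (hmax _ hFd hFp) ht
  have hsub : σ - F ε = ε • (σ - τ) := by simp only [F]; module
  have e1 := congrArg (fun M => logTrace M σ) hsub
  have e2 := congrArg (fun M => logTrace M (F ε)) hsub
  simp only [logTrace_sub_left σ (F ε), logTrace_smul_left] at e1 e2
  rw [htrF, sub_self] at k1 k2
  have habs := mul_le_mul_of_nonneg_right (le_abs_self (t - 1)) k1
  have habs2 := mul_le_mul_of_nonneg_left (a := |t - 1|)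
    (show logTrace σ σ - logTrace σ (F ε) ≤
      ε * (logTrace (σ - τ) σ - logTrace (σ - τ) (F ε)) by linarith) (abs_nonneg _)
  change _ ≤ logTrace _ (F ε) at hconc
  have eR : ∀ M, logTrace (t • ρ + (1 - t) • σ) M = t * logTrace ρ M + (1 - t) * logTrace σ M :=
    fun M => by rw [logTrace_add_left, logTrace_smul_left, logTrace_smul_left]
  rw [← mul_le_mul_iff_right₀ hε.1]
  have e3 := eR (F ε)
  have e4 := eR σ
  linarith

theorem logTrace_mix_one (A : Matrix d d ℂ) {B : Matrix d d ℂ} (hB : B.IsHermitian) (a b : ℝ) :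
    logTrace A (a • B + b • 1) = (A * cfc (fun x => Real.log (a * x + b)) B).trace.re := by
  have hsa : IsSelfAdjoint B := hB
  have hcont : ∀ f : ℝ → ℝ, ContinuousOn f (spectrum ℝ B) := fun f =>
    (Matrix.finite_real_spectrum (A := B)).continuousOn f
  have hfin : ((fun x : ℝ => a * x + b) '' spectrum ℝ B).Finite :=
    (Matrix.finite_real_spectrum (A := B)).image _
  rw [logTrace, cfc_comp' Real.log (fun x => a * x + b) B (hg := hfin.continuousOn _)
    (hf := hcont _), cfc_add_const b (fun x : ℝ => a * x) B (hf := hcont _),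
    cfc_const_mul a (fun x : ℝ => x) B (hf := hcont _), cfc_id' ℝ B,
    Algebra.algebraMap_eq_smul_one]

/-- In an eigenbasis of B the logarithms diverge or take a default value only where the eigenvalue
is 0, and there the kernel condition makes the weight of A vanish. -/
theorem tendsto_logTrace_mix_one {A B : Matrix d d ℂ} (hB : B.IsHermitian)
    (hker : ∀ x : d → ℂ, B *ᵥ x = 0 → A *ᵥ x = 0) (c : ℝ) :
    Tendsto (fun δ : ℝ => logTrace A ((1 - δ) • B + (δ * c) • 1)) (𝓝[>] 0)
      (𝓝 (logTrace A B)) := by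
  simp only [logTrace_mix_one A hB]
  simp only [logTrace, trace_mul_cfc A hB]
  refine tendsto_finsetSum _ fun j _ => ?_
  by_cases hj : hB.eigenvalues j = 0
  · have h0 : (star (hB.eigenvectorUnitary : Matrix d d ℂ) * A *
        (hB.eigenvectorUnitary : Matrix d d ℂ)) j j = 0 := by
      have h1 := hker _ (by
        have := hB.mulVec_eigenvectorBasis j
        rw [hj, zero_smul] at this
        exact this)
      rw [Matrix.mul_assoc, Matrix.mul_apply]
      refine Finset.sum_eq_zero fun k _ => ?_
      have : (A * (hB.eigenvectorUnitary : Matrix d d ℂ)) k j = 0 := congrFun h1 k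
      rw [this, mul_zero]
    simp [h0]
  · refine Tendsto.mul_const _ ?_
    have hc : ContinuousAt
        (fun δ : ℝ => Real.log ((1 - δ) * hB.eigenvalues j + δ * c)) 0 :=
      ContinuousAt.log (by fun_prop) (by simpa using hj)
    simpa using hc.tendsto.mono_left nhdsWithin_le_nhds

end Segment
-- Closest states on the ray, and its largest positive parameter
section Minimizers

variable {d : Type*} [Fintype d]

theorem IsState.mix {ρ σ : Matrix d d ℂ} (hρ : IsState ρ) (hσ : IsState σ) {a b : ℝ}
    (ha : 0 ≤ a) (hb : 0 ≤ b) (hab : a + b = 1) : IsState (a • ρ + b • σ) := by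
  refine ⟨(hρ.1.smul ha).add (hσ.1.smul hb), ?_⟩
  rw [Matrix.trace_add, Matrix.trace_smul, Matrix.trace_smul, hρ.2, hσ.2, ← add_smul, hab, one_smul]

theorem convex_setOf_isState : Convex ℝ {M : Matrix d d ℂ | IsState M} :=
  fun _ h1 _ h2 _ _ ha hb hab => IsState.mix h1 h2 ha hb hab

theorem IsState.segment {ρ σ : Matrix d d ℂ} (hρ : IsState ρ) (hσ : IsState σ) {t : ℝ}
    (h : (t • ρ + (1 - t) • σ).PosSemidef) : IsState (t • ρ + (1 - t) • σ) := by
  refine ⟨h, ?_⟩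
  rw [Matrix.trace_add, Matrix.trace_smul, Matrix.trace_smul, hρ.2, hσ.2, ← add_smul,
    add_sub_cancel, one_smul]

variable [DecidableEq d]

theorem relEntropy_of_ker_le {ρ σ : Matrix d d ℂ} (h : ∀ x : d → ℂ, σ *ᵥ x = 0 → ρ *ᵥ x = 0) :
    relEntropy ρ σ = ((logTrace ρ ρ - logTrace ρ σ : ℝ) : EReal) := by
  rw [relEntropy, if_pos h, Matrix.trace_sub, Complex.sub_re]
  rfl

theorem relEntropy_of_posDef (ρ : Matrix d d ℂ) {σ : Matrix d d ℂ} (hσ : σ.PosDef) :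
    relEntropy ρ σ = ((logTrace ρ ρ - logTrace ρ σ : ℝ) : EReal) :=
  relEntropy_of_ker_le fun x hx => by
    rw [Matrix.mulVec_injective_of_isUnit hσ.isUnit (hx.trans (Matrix.mulVec_zero σ).symm),
      Matrix.mulVec_zero]

theorem posDef_of_relEntropy_ne_top {ρ σ : Matrix d d ℂ} (hρ : ρ.PosDef) (hσ : σ.PosSemidef)
    (h : relEntropy ρ σ ≠ ⊤) : σ.PosDef := by
  have hker : ∀ x : d → ℂ, σ *ᵥ x = 0 → ρ *ᵥ x = 0 := by
    by_contra hn
    exact h (if_neg hn)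
  rw [hσ.posDef_iff_isUnit, ← Matrix.mulVec_injective_iff_isUnit]
  refine (injective_iff_map_eq_zero (Matrix.mulVecLin σ)).mpr fun x hx => ?_
  exact Matrix.mulVec_injective_of_isUnit hρ.isUnit
    ((hker x hx).trans (Matrix.mulVec_zero ρ).symm)

/-- If `σ` is a closest state of a full-rank `ρ` in a convex set of states that contains a multiple
of the identity, then it is a closest state of every state on the ray from `σ` through `ρ`. -/
theorem IsClosestState.ray {D : Set (Matrix d d ℂ)} (hconv : Convex ℝ D)
    (hst : ∀ τ ∈ D, IsState τ) {c : ℝ} (hc : 0 < c) (hcD : c • (1 : Matrix d d ℂ) ∈ D)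
    {ρ σ : Matrix d d ℂ} (hρ : ρ.PosDef) (hmin : IsClosestState D ρ σ) {t : ℝ} (ht : 0 ≤ t)
    (hR : (t • ρ + (1 - t) • σ).PosSemidef) :
    IsClosestState D (t • ρ + (1 - t) • σ) σ := by
  have hone : (c • (1 : Matrix d d ℂ)).PosDef := Matrix.PosDef.one.smul hc
  have hσ : σ.PosDef := by
    refine posDef_of_relEntropy_ne_top hρ (hst _ hmin.1).1 (ne_top_of_le_ne_top ?_ (hmin.2 _ hcD))
    rw [relEntropy_of_posDef ρ hone]
    exact EReal.coe_ne_top _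
  have hmax : ∀ τ ∈ D, τ.PosDef → logTrace ρ τ ≤ logTrace ρ σ := by
    intro τ hτD hτ
    have := hmin.2 τ hτD
    rw [relEntropy_of_posDef ρ hσ, relEntropy_of_posDef ρ hτ, EReal.coe_le_coe_iff] at this
    linarith
  refine ⟨hmin.1, fun τ hτD => ?_⟩
  by_cases hker : ∀ x : d → ℂ, τ *ᵥ x = 0 → (t • ρ + (1 - t) • σ) *ᵥ x = 0
  · rw [relEntropy_of_posDef _ hσ, relEntropy_of_ker_le hker, EReal.coe_le_coe_iff]
    refine sub_le_sub_left ?_ _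
    refine le_of_tendsto (tendsto_logTrace_mix_one (hst τ hτD).1.isHermitian hker c) ?_
    filter_upwards [Ioo_mem_nhdsGT (one_pos (α := ℝ))] with δ hδ
    rw [mul_smul]
    refine logTrace_le_of_isMinimum hconv (fun τ hτ => (hst τ hτ).2) hmin.1 hσ hmax ht hR
      (hconv hτD hcD (sub_pos.mpr hδ.2).le hδ.1.le (by ring)) ?_
    exact Matrix.PosDef.posSemidef_add ((hst τ hτD).1.smul (sub_pos.mpr hδ.2).le)
      (hone.smul hδ.1)
  · rw [relEntropy, relEntropy, if_neg hker]
    exact le_top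

theorem exists_isGreatest_segment {ρ σ : Matrix d d ℂ} (hρ : IsState ρ) (hρpos : ρ.PosDef)
    (hσ : IsState σ) (hne : ρ ≠ σ) :
    ∃ tmax : ℝ, 1 < tmax ∧ IsGreatest {t : ℝ | (t • ρ + (1 - t) • σ).PosSemidef} tmax := by
  set S := {t : ℝ | (t • ρ + (1 - t) • σ).PosSemidef} with hS
  have hclosed : IsClosed S := isClosed_setOf_posSemidef (by fun_prop)
  obtain ⟨u, hu, huS⟩ : ∃ u : ℝ, 0 < u ∧ 1 + u ∈ S := by
    obtain ⟨a, ha, hA⟩ := exists_pos_smul_one_le hρpos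
    obtain ⟨b, hb, hB⟩ := exists_pos_le_smul_one hσ.1.isHermitian
    -- With ρ ≥ a and σ ≤ b, the loss (a/b)σ is at most a, which ρ absorbs.
    refine ⟨a / b, by positivity, ?_⟩
    have h := (hA.add (hB.smul (div_pos ha hb).le)).add (hρ.1.smul (div_pos ha hb).le)
    have e : a = a / b * b := by field_simp
    have e2 : (1 + a / b) • ρ + (1 - (1 + a / b)) • σ =
        ρ - a • 1 + (a / b) • (b • 1 - σ) + (a / b) • ρ := by
      rw [smul_sub, smul_smul, ← e]; module
    rw [hS, Set.mem_ofPred_eq, e2]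
    exact h
  have hbdd : BddAbove S := by
    by_contra hn
    rw [not_bddAbove_iff] at hn
    have hcl : IsClosed {r : ℝ | ((ρ - σ) + r • σ).PosSemidef} :=
      isClosed_setOf_posSemidef (by fun_prop)
    -- Dividing ρ(t) by t → ∞ gives ρ - σ ≥ 0; having trace zero, it vanishes.
    have h0 : (0 : ℝ) ∈ {r : ℝ | ((ρ - σ) + r • σ).PosSemidef} := by
      rw [← hcl.closure_eq, Metric.mem_closure_iff]
      intro ε hε
      obtain ⟨t, htS, ht⟩ := hn ε⁻¹
      have htpos : 0 < t := (inv_pos.mpr hε).trans ht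
      refine ⟨t⁻¹, ?_, ?_⟩
      · have := Matrix.PosSemidef.smul (α := ℝ) htS (inv_pos.mpr htpos).le
        have e : (ρ - σ) + t⁻¹ • σ = t⁻¹ • (t • ρ + (1 - t) • σ) := by
          rw [smul_add, smul_smul, smul_smul, mul_sub, inv_mul_cancel₀ htpos.ne']; module
        rw [Set.mem_ofPred_eq, e]
        exact this
      · rw [dist_comm, Real.dist_eq, sub_zero, abs_of_pos (inv_pos.mpr htpos)]
        exact inv_lt_of_inv_lt₀ hε ht
    rw [Set.mem_ofPred_eq, zero_smul, add_zero] at h0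
    have := h0.trace_eq_zero_iff.mp (by rw [Matrix.trace_sub, hρ.2, hσ.2, sub_self])
    exact hne (sub_eq_zero.mp this)
  exact ⟨sSup S, (lt_add_of_pos_right 1 hu).trans_le (le_csSup hbdd huS),
    hclosed.csSup_mem ⟨_, huS⟩ hbdd, fun t ht => le_csSup hbdd ht⟩

end Minimizers

/-! ### Separable and PPT states: convexity and the maximally mixed state -/

section Tensor

variable {s : ℕ} {n : Fin s → ℕ}

theorem tensor_mul (A B : ∀ i : Fin s, Matrix (Fin (n i)) (Fin (n i)) ℂ) :
    tensor A * tensor B = tensor fun i => A i * B i := by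
  ext x y
  simp only [tensor, Matrix.mul_apply, Matrix.of_apply, ← Finset.prod_mul_distrib]
  rw [Finset.prod_univ_sum, Fintype.piFinset_univ]

theorem conjTranspose_tensor (A : ∀ i : Fin s, Matrix (Fin (n i)) (Fin (n i)) ℂ) :
    (tensor A)ᴴ = tensor fun i => (A i)ᴴ := by
  ext x y
  simp [tensor, Matrix.conjTranspose_apply]

theorem trace_tensor (A : ∀ i : Fin s, Matrix (Fin (n i)) (Fin (n i)) ℂ) :
    (tensor A).trace = ∏ i, (A i).trace := by
  simp only [tensor, Matrix.trace, Matrix.diag_apply, Matrix.of_apply]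
  rw [Finset.prod_univ_sum, Fintype.piFinset_univ]

theorem tensor_smul_one (c : Fin s → ℝ) :
    (tensor fun i => c i • (1 : Matrix (Fin (n i)) (Fin (n i)) ℂ)) = (∏ i, c i) • 1 := by
  ext x y
  simp only [tensor, Matrix.of_apply, Matrix.smul_apply, Matrix.one_apply, Complex.real_smul,
    Finset.prod_mul_distrib, Complex.ofReal_prod]
  congr 1
  rw [Finset.prod_boole]
  simp [funext_iff]

theorem isState_tensor {τ : ∀ i : Fin s, Matrix (Fin (n i)) (Fin (n i)) ℂ}
    (hτ : ∀ i, IsState (τ i)) : IsState (tensor τ) := by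
  constructor
  · have h : ∀ i, ∃ C : Matrix (Fin (n i)) (Fin (n i)) ℂ, τ i = Cᴴ * C := fun i =>
      exists_eq_conjTranspose_mul_self (hτ i).1
    choose C hC using h
    rw [funext hC, ← tensor_mul, ← conjTranspose_tensor]
    exact Matrix.posSemidef_conjTranspose_mul_self _
  · rw [trace_tensor]
    exact Finset.prod_eq_one fun i _ => (hτ i).2

theorem isState_smul_one {d : Type*} [Fintype d] [DecidableEq d] [Nonempty d] :
    IsState ((Fintype.card d : ℝ)⁻¹ • (1 : Matrix d d ℂ)) := by
  refine ⟨Matrix.PosSemidef.one.smul (by positivity), ?_⟩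
  rw [Matrix.trace_smul, Matrix.trace_one, Complex.real_smul]
  simp

theorem isState_of_mem_separableStates {M : Matrix (Idx n) (Idx n) ℂ}
    (hM : M ∈ separableStates n) : IsState M := by
  refine convexHull_min ?_ convex_setOf_isState hM
  rintro _ ⟨τ, hτ, rfl⟩
  exact isState_tensor hτ

theorem convex_pptStates (F : Set (Finset (Fin s))) : Convex ℝ (pptStates n F) := by
  intro A hA B hB a b ha hb hab
  refine ⟨hA.1.mix hB.1 ha hb hab, fun S hS => ?_⟩
  exact ((hA.2 S hS).smul ha).add ((hB.2 S hS).smul hb)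

theorem partialTranspose_smul_one (S : Finset (Fin s)) (c : ℝ) :
    partialTranspose S (c • (1 : Matrix (Idx n) (Idx n) ℂ)) = c • 1 := by
  ext x y
  simp only [partialTranspose, Matrix.of_apply, Matrix.smul_apply, Matrix.one_apply]
  congr 2
  simp only [funext_iff, eq_iff_iff]
  refine forall_congr' fun i => ?_
  split_ifs
  · exact eq_comm
  · rfl

theorem smul_one_mem_pptStates (F : Set (Finset (Fin s))) [Nonempty (Idx n)] :
    (Fintype.card (Idx n) : ℝ)⁻¹ • (1 : Matrix (Idx n) (Idx n) ℂ) ∈ pptStates n F := by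
  refine ⟨isState_smul_one, fun S _ => ?_⟩
  rw [partialTranspose_smul_one]
  exact isState_smul_one.1

theorem smul_one_mem_separableStates [hne : Nonempty (Idx n)] :
    (Fintype.card (Idx n) : ℝ)⁻¹ • (1 : Matrix (Idx n) (Idx n) ℂ) ∈ separableStates n := by
  refine subset_convexHull ℝ _
    ⟨fun i => (Fintype.card (Fin (n i)) : ℝ)⁻¹ • 1, fun i => ?_, ?_⟩
  · have : Nonempty (Fin (n i)) := ⟨hne.some i⟩
    exact isState_smul_one
  · rw [tensor_smul_one, Fintype.card_pi, Nat.cast_prod, Finset.prod_inv_distrib]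

end Tensor

end QState

theorem corollary4 {s : ℕ} (n : Fin s → ℕ)
    (D : Set (Matrix (QState.Idx n) (QState.Idx n) ℂ))
    (hD : D = QState.separableStates n ∨
      ∃ F : Set (Finset (Fin s)), D = QState.pptStates n F)
    (ρ σ : Matrix (QState.Idx n) (QState.Idx n) ℂ)
    (hρ : QState.IsState ρ) (hρ_pos : ρ.PosDef) (hρ_ent : ρ ∉ D)
    (hσ : QState.IsClosestState D ρ σ) :
    ∃ tmax : ℝ, 1 < tmax ∧
      IsGreatest {t : ℝ | (t • ρ + (1 - t) • σ).PosSemidef} tmax ∧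
      ∀ t ∈ Set.Icc 0 tmax,
        QState.IsState (t • ρ + (1 - t) • σ) ∧
        QState.IsClosestState D (t • ρ + (1 - t) • σ) σ := by
  -- Trace one excludes a zero local dimension.
  have hne : Nonempty (QState.Idx n) := by
    by_contra h
    rw [not_nonempty_iff] at h
    exact zero_ne_one ((Matrix.trace_eq_zero_of_isEmpty ρ).symm.trans hρ.2)
  obtain ⟨hconv, hst, hone⟩ : Convex ℝ D ∧ (∀ τ ∈ D, QState.IsState τ) ∧
      (Fintype.card (QState.Idx n) : ℝ)⁻¹ • (1 : Matrix (QState.Idx n) (QState.Idx n) ℂ) ∈ D := by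
    rcases hD with rfl | ⟨F, rfl⟩
    · exact ⟨convex_convexHull ℝ _, fun _ => QState.isState_of_mem_separableStates,
        QState.smul_one_mem_separableStates⟩
    · exact ⟨QState.convex_pptStates F, fun _ h => h.1, QState.smul_one_mem_pptStates F⟩
  have hσst := hst σ hσ.1
  obtain ⟨tmax, h1, hmax⟩ := QState.exists_isGreatest_segment hρ hρ_pos hσst
    (fun h => hρ_ent (h ▸ hσ.1))
  refine ⟨tmax, h1, hmax, fun t ht => ?_⟩
  have hpos : 0 < tmax := one_pos.trans h1
  have hR : (t • ρ + (1 - t) • σ).PosSemidef := by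
    have h := (hmax.1.smul (div_nonneg ht.1 hpos.le)).add
      (hσst.1.smul (sub_nonneg.mpr ((div_le_one hpos).mpr ht.2)))
    -- ρ(t) lies on the segment from σ to ρ(tmax), so it is positive by convexity.
    have e : t • ρ + (1 - t) • σ =
        (t / tmax) • (tmax • ρ + (1 - tmax) • σ) + (1 - t / tmax) • σ := by
      rw [smul_add, smul_smul, smul_smul, mul_sub, div_mul_cancel₀ t hpos.ne']; module
    rwa [e]
  exact ⟨hρ.segment hσst hR,
    hσ.ray hconv hst (inv_pos.mpr (Nat.cast_pos.mpr Fintype.card_pos)) hone hρ_pos ht.1 hR⟩
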